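/- Let $\mathcal P_n=\{\sigma_1\otimes\cdots\otimes\sigma_n:\sigma_i\in\{I,X,Y,Z\}\}$ and, for $P\in\pm\mathcal P_n$, let $R(P)=\frac{1+e^{i\pi/4}}2 I+\frac{1-e^{i\pi/4}}2P$. Let the $n$-qubit circuit $U$ be given in the form $$U=e^{i\phi}\Big(\prod_{j=1}^m R(P_j)\Big)C_0,\qquad P_j\in\pm\mathcal P_n,$$ with $C_0$ in the Clifford group (generated by $H$, $S$, $\mathrm{CNOT}$ on any of the qubits). Its T-graph $G_T(U)$ has vertices $v_1,\dots,v_m$ and an edge $(v_i,v_j)$ whenever $i<j$ and $[P_i,P_j]\neq0$. Consider the Clifford+T circuits $W$ on $n+t$ qubits ($t\ge0$ ancilla qubits, $t$ unrestricted) that can be obtained from $U$ using only the following two steps. (1) Finitely many times, exchange two adjacent rotations $R(P),R(Q)$ with $[P,Q]=0$. (2) Cut the resulting product into consecutive groups of pairwise commuting rotations and translate each group $\prod_{j=1}^r R(P'_j)$ into a circuit $A\,(T_{q_1}\cdots T_{q_r})\,A^{-1}$, where $q_1,\dots,q_r$ are distinct qubits among the $n+t$ and $A$ is a Clifford circuit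 on all $n+t$ qubits with $AZ_{q_j}A^{-1}=P'_j\otimes Q_j$ for some $Q_j\in\{I,Z\}^{\otimes t}$; the final Clifford is written as a Clifford circuit for $C_0\otimes I^{\otimes t}$. The T-depth of a Clifford+T circuit is the minimum number of T-cycles into which its $T$ gates can be grouped, a T-cycle being a set of $T$ gates on distinct qubits performed simultaneously, where only adjacent gates acting on disjoint sets of qubits may be exchanged in order to form the T-cycles. Then every such $W$ implements $U$ up to a global phase with the ancillas starting and ending in $|0\rangle$, i.e. there is $c\in\mathbb C$ with $|c|=1$ and $W(|\psi\rangle\otimes|0\rangle^{\otimes t})=c\,(U|\psi\rangle)\otimes|0\rangle^{\otimes t}$ for all $|\psi\rangle$; and the minimum of the T-depths of all such circuits $W$ exists and equals the number of vertices on the longest directed path in $G_T(U)$ (which is $0$ if $m=0$). -/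

import Mathlib

noncomputable section

namespace TDepth

open Matrix

/-! ### Operators on a finite register of qubits

`ι` is the set of qubits; computational basis states are functions `ι → Fin 2`. -/

/-- Operators on the qubits `ι`. -/
abbrev Op (ι : Type) := Matrix (ι → Fin 2) (ι → Fin 2) ℂ

section Operators

variable {ι : Type} [Fintype ι] [DecidableEq ι]

/-- The tensor product `⨂ i, A i` of one single-qubit operator per qubit. -/
def tensor (A : ι → Matrix (Fin 2) (Fin 2) ℂ) : Op ι :=
  Matrix.of fun x y => ∏ i, A i (x i) (y i)

/-- The single-qubit operator `u` acting on qubit `q`, identity elsewhere. -/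
def onQubit (u : Matrix (Fin 2) (Fin 2) ℂ) (q : ι) : Op ι :=
  tensor (Function.update (fun _ => 1) q u)

end Operators

/-- The names of the four single-qubit Pauli operators. -/
inductive Pauli
  | I | X | Y | Z

/-- The single-qubit Pauli matrices. -/
def Pauli.mat : Pauli → Matrix (Fin 2) (Fin 2) ℂ
  | .I => !![1, 0; 0, 1]
  | .X => !![0, 1; 1, 0]
  | .Y => !![0, -Complex.I; Complex.I, 0]
  | .Z => !![1, 0; 0, -1]

/-- An element `± σ₁ ⊗ ⋯ ⊗ σₙ` of `± 𝒫ₙ`. -/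
structure SignedPauli (ι : Type) where
  sign : ℤˣ
  axes : ι → Pauli

section Rotations

variable {ι : Type} [Fintype ι] [DecidableEq ι]

/-- The operator of a signed Pauli. -/
def SignedPauli.mat (P : SignedPauli ι) : Op ι :=
  (((P.sign : ℤ) : ℂ)) • tensor fun i => (P.axes i).mat

/-- The phase `e^{iπ/4}`. -/
def omega : ℂ := Complex.exp (Complex.I * (Real.pi / 4))

/-- The `π/4` rotation `R(P) = (1 + e^{iπ/4})/2 · I + (1 - e^{iπ/4})/2 · P`. -/
def SignedPauli.rot (P : SignedPauli ι) : Op ι :=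
  ((1 + omega) / 2) • (1 : Op ι) + ((1 - omega) / 2) • P.mat

end Rotations

/-! ### Clifford+T circuits -/

/-- The gates of the Clifford+T gate set on the qubits `ι`. -/
inductive Gate (ι : Type)
  | H (q : ι)
  | S (q : ι)
  | CNOT (c t : ι) (h : c ≠ t)
  | T (q : ι)

/-- Being a Clifford gate, i.e. any gate but `T`. -/
def Gate.IsClifford {ι : Type} : Gate ι → Prop
  | .T _ => False
  | _ => True

/-- The qubits a gate acts on. -/
def Gate.qubits {ι : Type} : Gate ι → Set ι
  | .H q => {q}
  | .S q => {q}
  | .CNOT c t _ => {c, t}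
  | .T q => {q}

/-- A Clifford+T circuit: the list of its gates, in the order in which they are written in a
product of operators (so the last gate of the list acts first). -/
abbrev Circuit (ι : Type) := List (Gate ι)

/-- A circuit without `T` gates. -/
def Circuit.IsClifford {ι : Type} (L : Circuit ι) : Prop :=
  ∀ g ∈ L, g.IsClifford

section Semantics

variable {ι : Type} [Fintype ι] [DecidableEq ι]

/-- The unitary of a gate. -/
def Gate.mat : Gate ι → Op ι
  | .H q => onQubit (((1 / Real.sqrt 2 : ℝ) : ℂ) • !![1, 1; 1, -1]) q
  | .S q => onQubit !![1, 0; 0, Complex.I] q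
  | .CNOT c t _ =>
      onQubit !![1, 0; 0, 0] c + onQubit !![0, 0; 0, 1] c * onQubit Pauli.X.mat t
  | .T q => onQubit !![1, 0; 0, omega] q

/-- The unitary of a circuit. -/
def Circuit.mat (L : Circuit ι) : Op ι := (L.map Gate.mat).prod

/-- Membership in the Clifford group, the group generated by `H`, `S` and `CNOT` on any of the
qubits. As `H² = S⁴ = CNOT² = 1`, products of these gates are already closed under inverses. -/
def IsCliffordOp (C : Op ι) : Prop :=
  ∃ L : Circuit ι, L.IsClifford ∧ L.mat = C

end Semantics

/-! ### T-depth of a circuit -/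

/-- Exchanging two adjacent gates that act on disjoint sets of qubits. -/
inductive Circuit.Slide {ι : Type} : Circuit ι → Circuit ι → Prop
  | mk (L₁ L₂ : Circuit ι) (g h : Gate ι) (hd : Disjoint g.qubits h.qubits) :
      Circuit.Slide (L₁ ++ g :: h :: L₂) (L₁ ++ h :: g :: L₂)

/-- `Layered L d`: the circuit `L` reads `K₀ T₁ K₁ T₂ ⋯ T_d K_d`, where the `Kᵢ` have no `T` gate
and each `Tᵢ` (a T-cycle) consists of `T` gates on distinct qubits. -/
inductive Circuit.Layered {ι : Type} : Circuit ι → ℕ → Prop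
  | clifford (K : Circuit ι) (hK : Circuit.IsClifford K) : Circuit.Layered K 0
  | cycle (K : Circuit ι) (hK : Circuit.IsClifford K) (qs : List ι) (hqs : qs.Nodup)
      (L : Circuit ι) (d : ℕ) (hL : Circuit.Layered L d) :
      Circuit.Layered (K ++ qs.map Gate.T ++ L) (d + 1)

/-- The `T` gates of `L` can be grouped into `d` T-cycles, the gates of a T-cycle being performed
simultaneously. Only gates on disjoint qubits are moved past each other. -/
def Circuit.HasTCycles {ι : Type} (L : Circuit ι) (d : ℕ) : Prop :=
  ∃ L' : Circuit ι, Relation.ReflTransGen Circuit.Slide L L' ∧ Circuit.Layered L' d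

/-- The T-depth of a circuit: the minimum number of T-cycles. -/
def Circuit.tDepth {ι : Type} (L : Circuit ι) : ℕ :=
  sInf {d | L.HasTCycles d}

/-- Every circuit has some grouping into T-cycles, so the minimum is attained. -/
theorem Circuit.exists_hasTCycles {ι : Type} (L : Circuit ι) : ∃ d, L.HasTCycles d := by
  suffices h : ∃ d, Circuit.Layered L d from
    h.imp fun d hd => ⟨L, Relation.ReflTransGen.refl, hd⟩
  have key : ∀ (g : Gate ι), g.IsClifford → ∀ (M : Circuit ι) (d : ℕ),
      Circuit.Layered M d → Circuit.Layered (g :: M) d := by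
    intro g hg M d hM
    cases hM with
    | clifford K hK =>
      refine .clifford _ ?_
      intro a ha
      rcases List.mem_cons.1 ha with rfl | ha
      · exact hg
      · exact hK a ha
    | cycle K hK qs hqs L d hL =>
      refine Circuit.Layered.cycle (g :: K) ?_ qs hqs L d hL
      intro a ha
      rcases List.mem_cons.1 ha with rfl | ha
      · exact hg
      · exact hK a ha
  induction L with
  | nil => exact ⟨0, .clifford [] (by intro g hg; cases hg)⟩
  | cons g L ih =>
    obtain ⟨d, hd⟩ := ih
    cases g with
    | T q =>
      exact ⟨d + 1, Circuit.Layered.cycle [] (by intro g hg; cases hg) [q] (by simp) L d hd⟩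
    | H q => exact ⟨d, key (.H q) trivial L d hd⟩
    | S q => exact ⟨d, key (.S q) trivial L d hd⟩
    | CNOT c t h => exact ⟨d, key (.CNOT c t h) trivial L d hd⟩

/-! ### Circuits as products of rotations, and their T-graph -/

/-- A circuit on `n` qubits given in the form `e^{iφ} (∏ⱼ R(Pⱼ)) C₀`, with `C₀` Clifford. -/
structure RotationForm (n : ℕ) where
  phase : ℝ
  paulis : List (SignedPauli (Fin n))
  clifford : Op (Fin n)
  isClifford : IsCliffordOp clifford

/-- The unitary of a product of rotations. -/
def RotationForm.mat {n : ℕ} (U : RotationForm n) : Op (Fin n) :=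
  Complex.exp (Complex.I * U.phase) • ((U.paulis.map SignedPauli.rot).prod * U.clifford)

/-- The T-graph: one vertex per rotation and an edge `(vᵢ, vⱼ)` iff `[Pᵢ, Pⱼ] ≠ 0` and `i < j`. -/
def RotationForm.tGraph {n : ℕ} (U : RotationForm n) : Digraph (Fin U.paulis.length) where
  Adj i j := ¬ Commute (U.paulis.get i).mat (U.paulis.get j).mat ∧ i < j

/-- Directed paths of a digraph, as lists of distinct vertices, consecutive ones joined by an
edge. -/
def IsDiPath {V : Type} (G : Digraph V) (p : List V) : Prop :=
  p.IsChain G.Adj ∧ p.Nodup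

/-! ### The permitted transformations -/

/-- One use of the commutation rule: exchange adjacent rotations `R(P)`, `R(Q)` if
`[P, Q] = 0`. -/
inductive CommSwap {n : ℕ} : List (SignedPauli (Fin n)) → List (SignedPauli (Fin n)) → Prop
  | mk (l₁ l₂ : List (SignedPauli (Fin n))) (P Q : SignedPauli (Fin n))
      (h : Commute P.mat Q.mat) :
      CommSwap (l₁ ++ P :: Q :: l₂) (l₁ ++ Q :: P :: l₂)

/-- The extension `P ⊗ Q` of a signed Pauli `P` to a register with `t` ancilla qubits. -/
def SignedPauli.extend {n t : ℕ} (P : SignedPauli (Fin n)) (Q : Fin t → Pauli) :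
    SignedPauli (Fin n ⊕ Fin t) where
  sign := P.sign
  axes := Sum.elim P.axes Q

/-- The extension `C ⊗ I` of an operator to a register with `t` ancilla qubits. -/
def extendOp {n : ℕ} (t : ℕ) (C : Op (Fin n)) : Op (Fin n ⊕ Fin t) :=
  Matrix.of fun x y =>
    C (x ∘ Sum.inl) (y ∘ Sum.inl) *
      (1 : Op (Fin t)) (x ∘ Sum.inr) (y ∘ Sum.inr)

/-- The state `|ψ⟩ ⊗ |0⟩^{⊗ t}`. -/
def withAncillas {n : ℕ} (t : ℕ) (ψ : (Fin n → Fin 2) → ℂ) : (Fin n ⊕ Fin t → Fin 2) → ℂ :=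
  fun x => if x ∘ Sum.inr = 0 then ψ (x ∘ Sum.inl) else 0

/-- Ancilla-assisted layering of a group `∏ⱼ R(Pⱼ)` of pairwise commuting rotations: it is
translated into a circuit `A (T_{q₁} ⋯ T_{q_m}) A⁻¹`, the `qⱼ` being distinct qubits and `A`
a Clifford circuit on the register extended by `t` ancilla qubits, with
`A Z_{qⱼ} A⁻¹ = Pⱼ ⊗ Qⱼ` for some `Qⱼ ∈ {I, Z}^{⊗ t}`. -/
def IsTLayerOf {n t : ℕ} (Ps : List (SignedPauli (Fin n)))
    (B : Circuit (Fin n ⊕ Fin t)) : Prop :=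
  Ps.Pairwise (fun P Q => Commute P.mat Q.mat) ∧
  ∃ (A A' : Circuit (Fin n ⊕ Fin t)) (qs : List (Fin n ⊕ Fin t)),
    A.IsClifford ∧ A'.IsClifford ∧ A.mat * A'.mat = 1 ∧ qs.Nodup ∧
    List.Forall₂ (fun P q => ∃ Q : Fin t → Pauli, (∀ a, Q a = Pauli.I ∨ Q a = Pauli.Z) ∧
      A.mat * onQubit Pauli.Z.mat q * A'.mat = (P.extend Q).mat) Ps qs ∧
    B = A ++ qs.map Gate.T ++ A'

/-- `W` is a Clifford+T circuit with `t` ancilla qubits obtained from `U` by the permitted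
transformations only: finitely many commutation swaps, then cutting the product of rotations
into consecutive groups and translating each of them by ancilla-assisted layering; the final
Clifford `C₀` is written as a Clifford circuit for `C₀ ⊗ I`. -/
def Derives {n : ℕ} (U : RotationForm n) (t : ℕ) (W : Circuit (Fin n ⊕ Fin t)) : Prop :=
  ∃ (groups : List (List (SignedPauli (Fin n)))) (blocks : List (Circuit (Fin n ⊕ Fin t)))
    (K : Circuit (Fin n ⊕ Fin t)),
    Relation.ReflTransGen CommSwap U.paulis groups.flatten ∧
    List.Forall₂ IsTLayerOf groups blocks ∧
    K.IsClifford ∧ K.mat = extendOp t U.clifford ∧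
    W = blocks.flatten ++ K

/-- `W` implements `U` up to a global phase, with ancillas starting and ending in `|0⟩`:
`W (|ψ⟩ ⊗ |0⟩) = c (U |ψ⟩) ⊗ |0⟩`. -/
def Implements {n t : ℕ} (W : Circuit (Fin n ⊕ Fin t)) (U : RotationForm n) : Prop :=
  ∃ c : ℂ, ‖c‖ = 1 ∧ ∀ ψ : (Fin n → Fin 2) → ℂ,
    W.mat *ᵥ withAncillas t ψ = c • withAncillas t (U.mat *ᵥ ψ)

end TDepth

end

/-! Both quantities are governed by one invariant of a list of operators under exchange of adjacent
commuting entries: the length of a longest chain, a subsequence whose consecutive entries do not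
commute. Edges of the T-graph increase the index, so its directed paths are exactly the chains of
`U.paulis` (`exists_isDiPath_iff`).

Lower bound. Pushing the Cliffords of a circuit to the right turns each `T` gate into a rotation
about an axis `C Z_q C⁻¹`. Sliding gates exchanges only commuting axes (`Circuit.Slide.axes`), and
the axes of one T-cycle commute, so a chain of axes meets each T-cycle at most once. The axes of a
derived circuit are `P ⊗ Q` with `Q` diagonal, and these commute only if the `P` do
(`SignedPauli.commute_of_extend`); hence chains of `U.paulis` become chains of axes.

Upper bound. Exchanges bring the rotations into greedy commuting blocks, each entry failing to
commute with some entry of the next block (`exists_isGreedy`); following such entries gives a chain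
with one entry per block. Each block costs one T-cycle when every rotation has its own ancilla: a
Clifford flip of ancilla `a` controlled by `P` conjugates `Z_a` to `P ⊗ Z_a`, and flips for
commuting Paulis do not disturb each other (`exists_clifford_conj`).

Correctness holds because `Q ∈ {I, Z}^{⊗ t}` fixes `|0⟩`, so `R(P ⊗ Q)` acts as `R(P)` when the
ancillas are in `|0⟩`. -/

namespace TDepth

open Matrix

/-! ### Chains and greedy blocks in lists with partial commutation -/

section Lists

variable {α β : Type*}

/-- Exchanging two adjacent entries related by `C`. -/
inductive AdjSwap (C : α → α → Prop) : List α → List α → Prop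
  | mk (l₁ l₂ : List α) (a b : α) (h : C a b) : AdjSwap C (l₁ ++ a :: b :: l₂) (l₁ ++ b :: a :: l₂)

/-- `l` has a subsequence of length `k` whose consecutive entries are not related by `C`. -/
def HasChain (C : α → α → Prop) (l : List α) (k : ℕ) : Prop :=
  ∃ s : List α, s.Sublist l ∧ s.IsChain (fun a b => ¬ C a b) ∧ s.length = k

theorem AdjSwap.append_left {C : α → α → Prop} {l l' : List α} (h : AdjSwap C l l') (m : List α) :
    AdjSwap C (m ++ l) (m ++ l') := by
  cases h with
  | mk l₁ l₂ a b h => simpa using AdjSwap.mk (m ++ l₁) l₂ a b h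

theorem reflTransGen_append_left {C : α → α → Prop} {l l' : List α}
    (h : Relation.ReflTransGen (AdjSwap C) l l') (m : List α) :
    Relation.ReflTransGen (AdjSwap C) (m ++ l) (m ++ l') :=
  h.lift (m ++ ·) fun _ _ h => h.append_left m

theorem AdjSwap.symm {C : α → α → Prop} (hC : ∀ a b, C a b → C b a) {l l' : List α}
    (h : AdjSwap C l l') : AdjSwap C l' l := by
  cases h with
  | mk l₁ l₂ a b h => exact .mk l₁ l₂ b a (hC _ _ h)

/-- A chain cannot use both exchanged entries: they would be consecutive in it, yet they are
related. So the same chain survives the exchange. -/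
theorem AdjSwap.hasChain {C : α → α → Prop} {l l' : List α} (h : AdjSwap C l l') {k : ℕ}
    (hk : HasChain C l k) : HasChain C l' k := by
  cases h with
  | mk l₁ l₂ a b hab =>
    obtain ⟨s, hs, hc, rfl⟩ := hk
    obtain ⟨s₁, s₂, rfl, h₁, h₂⟩ := List.sublist_append_iff.1 hs
    refine ⟨s₁ ++ s₂, h₁.append ?_, hc, rfl⟩
    cases h₂ with
    | cons _ h₂ =>
      cases h₂ with
      | cons _ h₂ => exact (h₂.cons _).cons _
      | cons_cons _ h₂ => exact (h₂.cons _).cons_cons _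
    | cons_cons _ h₂ =>
      cases h₂ with
      | cons _ h₂ => exact (h₂.cons_cons _).cons _
      | cons_cons _ h₂ =>
        have := hc.right_of_append
        simp [hab] at this

theorem hasChain_of_reflTransGen {C : α → α → Prop} {l l' : List α}
    (h : Relation.ReflTransGen (AdjSwap C) l l') {k : ℕ} (hk : HasChain C l k) :
    HasChain C l' k := by
  induction h with
  | refl => exact hk
  | tail _ h ih => exact h.hasChain ih

/-- Transports chains from Paulis to the axes of a circuit; only the implication from commuting axes
back to commuting Paulis is needed. -/
theorem HasChain.of_forall₂ {C : α → α → Prop} {D : β → β → Prop} {R : α → β → Prop}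
    (hR : ∀ a b a' b', R a b → R a' b' → D b b' → C a a') {l : List α} {m : List β}
    (h : List.Forall₂ R l m) {k : ℕ} (hk : HasChain C l k) : HasChain D m k := by
  obtain ⟨s, hs, hc, rfl⟩ := hk
  obtain ⟨s', hs', hsm⟩ : ∃ s', List.Forall₂ R s s' ∧ s'.Sublist m := by
    clear hc
    induction h generalizing s with
    | nil => exact ⟨[], by rw [List.sublist_nil.1 hs]; exact .nil, .refl _⟩
    | cons hab _ ih =>
      cases hs with
      | cons _ hs =>
        obtain ⟨s', h₁, h₂⟩ := ih _ hs
        exact ⟨s', h₁, h₂.cons _⟩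
      | cons_cons _ hs =>
        obtain ⟨s', h₁, h₂⟩ := ih _ hs
        exact ⟨_ :: s', .cons hab h₁, h₂.cons_cons _⟩
  refine ⟨s', hsm, ?_, hs'.length_eq.symm⟩
  clear hs hsm h
  induction hs' with
  | nil => exact .nil
  | cons hab h ih =>
    cases h with
    | nil => exact .singleton _
    | cons hab' h =>
      rw [List.isChain_cons_cons] at hc ⊢
      exact ⟨fun hD => hc.1 (hR _ _ _ _ hab hab' hD), ih hc.2⟩

/-- A chain meets each block of pairwise related entries at most once. -/
theorem HasChain.le_length {C : α → α → Prop} {gs : List (List α)}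
    (hgs : ∀ g ∈ gs, g.Pairwise C) {k : ℕ} (hk : HasChain C gs.flatten k) : k ≤ gs.length := by
  induction gs generalizing k with
  | nil =>
    obtain ⟨s, hs, -, rfl⟩ := hk
    simp_all
  | cons g gs ih =>
    obtain ⟨s, hs, hc, rfl⟩ := hk
    rw [List.flatten_cons] at hs
    obtain ⟨s₁, s₂, rfl, h₁, h₂⟩ := List.sublist_append_iff.1 hs
    have h2 := ih (fun g hg => hgs g (List.mem_cons_of_mem _ hg)) ⟨s₂, h₂, hc.right_of_append, rfl⟩
    have h1 : s₁.length ≤ 1 := by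
      have hp := (hgs g List.mem_cons_self).sublist h₁
      have hl := hc.left_of_append
      rcases s₁ with _ | ⟨a, _ | ⟨b, r⟩⟩
      · simp
      · simp
      · simp_all
    simp only [List.length_append, List.length_cons]
    omega

/-- Blocks of pairwise related entries such that every entry of a block is unrelated to some entry
of the next block. -/
def IsGreedy (C : α → α → Prop) (gs : List (List α)) : Prop :=
  (∀ g ∈ gs, g.Pairwise C ∧ g ≠ []) ∧ gs.IsChain (fun g h => ∀ a ∈ g, ∃ b ∈ h, ¬ C a b)

/-- From any starting entry, an unrelated entry can be picked in the next block, and so on to the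
last block. -/
theorem IsGreedy.hasChain {C : α → α → Prop} {g : List α} {gs : List (List α)}
    (h : IsGreedy C (g :: gs)) (a : α) (ha : a ∈ g) :
    ∃ s, (a :: s).Sublist (g :: gs).flatten ∧ (a :: s).IsChain (fun a b => ¬ C a b) ∧
      (a :: s).length = (g :: gs).length := by
  induction gs generalizing g a with
  | nil => exact ⟨[], by simpa using ha, .singleton _, rfl⟩
  | cons g' gs ih =>
    obtain ⟨h₁, h₂⟩ := h
    rw [List.isChain_cons_cons] at h₂
    obtain ⟨b, hb, hab⟩ := h₂.1 a ha
    obtain ⟨s, hs, hc, hl⟩ := ih ⟨fun g hg => h₁ g (List.mem_cons_of_mem _ hg), h₂.2⟩ b hb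
    refine ⟨b :: s, ?_, List.isChain_cons_cons.2 ⟨hab, hc⟩, by simp_all⟩
    rw [List.flatten_cons]
    exact (List.singleton_sublist.2 ha).append hs

theorem reflTransGen_move_right {C : α → α → Prop} (a : α) (g l : List α) (h : ∀ b ∈ g, C a b) :
    Relation.ReflTransGen (AdjSwap C) (a :: (g ++ l)) (g ++ a :: l) := by
  induction g with
  | nil => exact .refl
  | cons b g ih =>
    refine .head (.mk [] _ a b (h b List.mem_cons_self)) ?_
    exact reflTransGen_append_left (ih fun b hb => h b (List.mem_cons_of_mem _ hb)) [b]

/-- The new entry moves right past whole blocks related to it and joins the last block before an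
obstruction. The clause `g ⊆ g'` keeps the greedy link from a preceding block: its witnesses are
still present. -/
theorem IsGreedy.insert_of_forall {C : α → α → Prop} {g : List α} {gs : List (List α)}
    (h : IsGreedy C (g :: gs)) (a : α) (ha : ∀ b ∈ g, C a b) :
    ∃ g' gs', IsGreedy C (g' :: gs') ∧ g ⊆ g' ∧
      Relation.ReflTransGen (AdjSwap C) (a :: (g :: gs).flatten) (g' :: gs').flatten := by
  induction gs generalizing g with
  | nil =>
    refine ⟨a :: g, [], ⟨?_, .singleton _⟩, List.subset_cons_self _ _, .refl⟩
    have := h.1 g List.mem_cons_self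
    simpa [this.1] using ha
  | cons g' gs ih =>
    obtain ⟨h₁, h₂⟩ := h
    rw [List.isChain_cons_cons] at h₂
    by_cases hg' : ∃ b ∈ g', ¬ C a b
    · refine ⟨a :: g, g' :: gs, ⟨?_, ?_⟩, List.subset_cons_self _ _, .refl⟩
      · rw [List.forall_mem_cons] at h₁ ⊢
        exact ⟨⟨List.pairwise_cons.2 ⟨ha, h₁.1.1⟩, by simp⟩, h₁.2⟩
      · rw [List.isChain_cons_cons, List.forall_mem_cons]
        exact ⟨⟨hg', h₂.1⟩, h₂.2⟩
    · push Not at hg'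
      rw [List.forall_mem_cons] at h₁
      obtain ⟨k, ks, hk, hsub, hsw⟩ := ih ⟨h₁.2, h₂.2⟩ hg'
      refine ⟨g, k :: ks, ⟨?_, ?_⟩, List.Subset.refl _, ?_⟩
      · exact List.forall_mem_cons.2 ⟨h₁.1, hk.1⟩
      · refine List.isChain_cons_cons.2 ⟨fun x hx => ?_, hk.2⟩
        obtain ⟨b, hb, hxb⟩ := h₂.1 x hx
        exact ⟨b, hsub hb, hxb⟩
      · exact (reflTransGen_move_right a g _ ha).trans (reflTransGen_append_left hsw g)

/-- Every list can be rearranged by exchanges of adjacent related entries into greedy blocks. -/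
theorem exists_isGreedy (C : α → α → Prop) (l : List α) :
    ∃ gs, IsGreedy C gs ∧ Relation.ReflTransGen (AdjSwap C) l gs.flatten := by
  induction l with
  | nil => exact ⟨[], ⟨by simp, .nil⟩, .refl⟩
  | cons a l ih =>
    obtain ⟨gs, hgs, hsw⟩ := ih
    have hsw' := reflTransGen_append_left hsw [a]
    rcases gs with _ | ⟨g, gs⟩
    · exact ⟨[[a]], ⟨by simp, .singleton _⟩, hsw'⟩
    · by_cases hg : ∃ b ∈ g, ¬ C a b
      · refine ⟨[a] :: g :: gs, ⟨?_, ?_⟩, hsw'⟩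
        · exact List.forall_mem_cons.2 ⟨by simp, hgs.1⟩
        · exact List.isChain_cons_cons.2 ⟨by simpa using hg, hgs.2⟩
      · push Not at hg
        obtain ⟨k, ks, hk, -, hs⟩ := hgs.insert_of_forall a hg
        exact ⟨k :: ks, hk, hsw'.trans hs⟩

/-- The number of greedy blocks is the length of a longest chain. -/
theorem IsGreedy.hasChain_length {C : α → α → Prop} (hC : ∀ a b, C a b → C b a) {l : List α}
    {gs : List (List α)} (h : IsGreedy C gs)
    (hl : Relation.ReflTransGen (AdjSwap C) l gs.flatten) : HasChain C l gs.length := by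
  have hsymm : Std.Symm (AdjSwap C) := ⟨fun _ _ h => h.symm hC⟩
  have hl' : Relation.ReflTransGen (AdjSwap C) gs.flatten l :=
    Relation.ReflTransGen.stdSymm.symm _ _ hl
  refine hasChain_of_reflTransGen hl' ?_
  rcases gs with _ | ⟨g, gs⟩
  · exact ⟨[], by simp, .nil, rfl⟩
  · obtain ⟨a, ha⟩ := List.exists_mem_of_ne_nil _ (h.1 g List.mem_cons_self).2
    obtain ⟨s, hs⟩ := h.hasChain a ha
    exact ⟨_, hs⟩

end Lists

/-! ### Paths of the T-graph as chains -/

theorem commSwap_iff {n : ℕ} {l l' : List (SignedPauli (Fin n))} :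
    CommSwap l l' ↔ AdjSwap (fun P Q => Commute P.mat Q.mat) l l' := by
  constructor <;> rintro ⟨l₁, l₂, P, Q, h⟩ <;> exact .mk l₁ l₂ P Q h

/-- Directed paths of the T-graph are the chains of non-commuting rotations. -/
theorem exists_isDiPath_iff {n : ℕ} (U : RotationForm n) (k : ℕ) :
    (∃ p : List (Fin U.paulis.length), IsDiPath U.tGraph p ∧ p.length = k) ↔
      HasChain (fun P Q : SignedPauli (Fin n) => Commute P.mat Q.mat) U.paulis k := by
  constructor
  · rintro ⟨p, ⟨hp, -⟩, rfl⟩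
    -- Edges increase the index, so a path is a strictly increasing list of positions, that is, a
    -- subsequence.
    have hlt : p.Pairwise (· < ·) := (hp.imp fun _ _ h => h.2).pairwise
    refine ⟨p.map (U.paulis[·]), ?_, ?_, by simp⟩
    · exact List.map_getElem_sublist hlt
    · rw [List.isChain_map]
      exact hp.imp fun _ _ h => h.1
  · rintro ⟨s, hs, hc, rfl⟩
    obtain ⟨p, rfl, hlt⟩ := List.sublist_eq_map_getElem hs
    refine ⟨p, ⟨?_, hlt.imp fun h => h.ne⟩, by simp⟩
    rw [List.isChain_map] at hc
    have := hlt.isChain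
    rw [List.isChain_iff_getElem] at *
    exact fun i hi => ⟨hc i hi, this i hi⟩

/-! ### Algebra of tensor products and single-qubit operators -/

theorem tensor_one {ι : Type} [Fintype ι] : tensor (fun _ : ι => 1) = 1 := by
  ext x y
  simp only [tensor, Matrix.of_apply, Matrix.one_apply]
  by_cases h : x = y
  · simp [h]
  · obtain ⟨i, hi⟩ := Function.ne_iff.1 h
    rw [if_neg h]
    exact Finset.prod_eq_zero (Finset.mem_univ i) (if_neg hi)

section Tensor

variable {ι : Type} [Fintype ι] [DecidableEq ι]

theorem tensor_mul (A B : ι → Matrix (Fin 2) (Fin 2) ℂ) :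
    tensor A * tensor B = tensor fun i => A i * B i := by
  ext x y
  simp only [tensor, Matrix.mul_apply, Matrix.of_apply, Finset.prod_univ_sum,
    Fintype.piFinset_univ, Finset.prod_mul_distrib]

theorem tensor_commute {A B : ι → Matrix (Fin 2) (Fin 2) ℂ} (h : ∀ i, Commute (A i) (B i)) :
    Commute (tensor A) (tensor B) := by
  rw [commute_iff_eq, tensor_mul, tensor_mul]
  exact congrArg _ (funext fun i => h i)

theorem tensor_commute_onQubit {A : ι → Matrix (Fin 2) (Fin 2) ℂ} {q : ι}
    {u : Matrix (Fin 2) (Fin 2) ℂ} (h : Commute (A q) u) : Commute (tensor A) (onQubit u q) := by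
  refine tensor_commute fun i => ?_
  rcases eq_or_ne i q with rfl | hi
  · simpa using h
  · simp [hi]

theorem onQubit_apply (u : Matrix (Fin 2) (Fin 2) ℂ) (q : ι) (x y : ι → Fin 2) :
    onQubit u q x y =
      u (x q) (y q) * ∏ i ∈ Finset.univ.erase q, (1 : Matrix (Fin 2) (Fin 2) ℂ) (x i) (y i) := by
  simp only [onQubit, tensor, Matrix.of_apply]
  rw [← Finset.mul_prod_erase _ _ (Finset.mem_univ q), Function.update_self]
  congr 1
  refine Finset.prod_congr rfl fun i hi => ?_
  rw [Function.update_of_ne (Finset.ne_of_mem_erase hi)]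

theorem onQubit_one (q : ι) : onQubit 1 q = 1 := by
  rw [← tensor_one, onQubit, Function.update_eq_self_iff.2 rfl]

theorem onQubit_add (u v : Matrix (Fin 2) (Fin 2) ℂ) (q : ι) :
    onQubit (u + v) q = onQubit u q + onQubit v q := by
  ext x y
  simp only [Matrix.add_apply, onQubit_apply, add_mul]

theorem onQubit_smul (c : ℂ) (u : Matrix (Fin 2) (Fin 2) ℂ) (q : ι) :
    onQubit (c • u) q = c • onQubit u q := by
  ext x y
  simp only [Matrix.smul_apply, onQubit_apply, smul_eq_mul, mul_assoc]

theorem onQubit_sub (u v : Matrix (Fin 2) (Fin 2) ℂ) (q : ι) :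
    onQubit (u - v) q = onQubit u q - onQubit v q := by
  ext x y
  simp only [Matrix.sub_apply, onQubit_apply, sub_mul]

theorem onQubit_zero (q : ι) : onQubit 0 q = 0 := by
  ext x y
  simp [onQubit_apply]

theorem onQubit_mul (u v : Matrix (Fin 2) (Fin 2) ℂ) (q : ι) :
    onQubit u q * onQubit v q = onQubit (u * v) q := by
  rw [onQubit, onQubit, tensor_mul, onQubit]
  congr 1
  funext i
  rcases eq_or_ne i q with rfl | hi <;> simp [*]

theorem onQubit_commute {p q : ι} (h : p ≠ q) (u v : Matrix (Fin 2) (Fin 2) ℂ) :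
    Commute (onQubit u p) (onQubit v q) := by
  refine tensor_commute_onQubit ?_
  simp [h.symm]

theorem Pauli.mat_mul_self (σ : Pauli) : σ.mat * σ.mat = 1 := by
  cases σ <;> ext i j <;> fin_cases i <;> fin_cases j <;> simp [Pauli.mat]

theorem SignedPauli.mat_mul_self (P : SignedPauli ι) : P.mat * P.mat = 1 := by
  rw [SignedPauli.mat, smul_mul_smul_comm, tensor_mul]
  simp only [Pauli.mat_mul_self, tensor_one]
  rcases Int.units_eq_one_or P.sign with h | h <;> simp [h]

end Tensor

/-! ### Single-qubit gate identities and Clifford operators -/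

section Gates

variable {ι : Type} [Fintype ι] [DecidableEq ι]

theorem hadamard_mul_self :
    (((1 / Real.sqrt 2 : ℝ) : ℂ) • !![1, 1; 1, -1] : Matrix (Fin 2) (Fin 2) ℂ) *
      (((1 / Real.sqrt 2 : ℝ) : ℂ) • !![1, 1; 1, -1]) = 1 := by
  have h : (((1 / Real.sqrt 2 : ℝ) : ℂ)) * ((1 / Real.sqrt 2 : ℝ) : ℂ) = 1 / 2 := by
    rw [← Complex.ofReal_mul, div_mul_div_comm, Real.mul_self_sqrt zero_le_two]
    norm_num
  rw [smul_mul_smul_comm, h]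
  ext i j
  fin_cases i <;> fin_cases j <;> norm_num [Matrix.mul_apply, Fin.sum_univ_two]

theorem hadamard_conj_Z :
    (((1 / Real.sqrt 2 : ℝ) : ℂ) • !![1, 1; 1, -1] : Matrix (Fin 2) (Fin 2) ℂ) * Pauli.Z.mat *
      (((1 / Real.sqrt 2 : ℝ) : ℂ) • !![1, 1; 1, -1]) = Pauli.X.mat := by
  have h : (((1 / Real.sqrt 2 : ℝ) : ℂ)) * ((1 / Real.sqrt 2 : ℝ) : ℂ) = 1 / 2 := by
    rw [← Complex.ofReal_mul, div_mul_div_comm, Real.mul_self_sqrt zero_le_two]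
    norm_num
  rw [smul_mul_assoc, smul_mul_smul_comm, h]
  ext i j
  fin_cases i <;> fin_cases j <;>
    norm_num [Matrix.mul_apply, Fin.sum_univ_two, Pauli.mat]

theorem phase_mul_self :
    (!![1, 0; 0, Complex.I] : Matrix (Fin 2) (Fin 2) ℂ) * !![1, 0; 0, Complex.I] =
      Pauli.Z.mat := by
  ext i j
  fin_cases i <;> fin_cases j <;> simp [Pauli.mat]

/-- The factor `S Z = S³` is `S⁻¹`, written as a product of Clifford matrices. -/
theorem phase_conj_X :
    (!![1, 0; 0, Complex.I] : Matrix (Fin 2) (Fin 2) ℂ) * Pauli.X.mat *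
      (!![1, 0; 0, Complex.I] * Pauli.Z.mat) = Pauli.Y.mat := by
  ext i j
  fin_cases i <;> fin_cases j <;> simp [Pauli.mat]

theorem phase_mul_inv :
    (!![1, 0; 0, Complex.I] : Matrix (Fin 2) (Fin 2) ℂ) *
      (!![1, 0; 0, Complex.I] * Pauli.Z.mat) = 1 := by
  ext i j
  fin_cases i <;> fin_cases j <;> simp [Pauli.mat]

theorem IsCliffordOp.mul {C D : Op ι} (hC : IsCliffordOp C) (hD : IsCliffordOp D) :
    IsCliffordOp (C * D) := by
  obtain ⟨L, hL, rfl⟩ := hC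
  obtain ⟨M, hM, rfl⟩ := hD
  refine ⟨L ++ M, ?_, by simp [Circuit.mat]⟩
  intro g hg
  rcases List.mem_append.1 hg with hg | hg
  exacts [hL g hg, hM g hg]

theorem isCliffordOp_one : IsCliffordOp (1 : Op ι) :=
  ⟨[], fun _ h => (List.not_mem_nil h).elim, rfl⟩

theorem isCliffordOp_gate {g : Gate ι} (hg : g.IsClifford) : IsCliffordOp g.mat :=
  ⟨[g], fun _ h => List.mem_singleton.1 h ▸ hg, by simp [Circuit.mat]⟩

theorem isCliffordOp_H (q : ι) :
    IsCliffordOp (onQubit (((1 / Real.sqrt 2 : ℝ) : ℂ) • !![1, 1; 1, -1]) q) :=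
  isCliffordOp_gate (g := .H q) trivial

theorem isCliffordOp_S (q : ι) : IsCliffordOp (onQubit !![1, 0; 0, Complex.I] q) :=
  isCliffordOp_gate (g := .S q) trivial

theorem isCliffordOp_Z (q : ι) : IsCliffordOp (onQubit Pauli.Z.mat q) := by
  rw [← phase_mul_self, ← onQubit_mul]
  exact (isCliffordOp_S q).mul (isCliffordOp_S q)

theorem isCliffordOp_X (q : ι) : IsCliffordOp (onQubit Pauli.X.mat q) := by
  rw [← hadamard_conj_Z, ← onQubit_mul, ← onQubit_mul]
  exact ((isCliffordOp_H q).mul (isCliffordOp_Z q)).mul (isCliffordOp_H q)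

end Gates

/-! ### Controlled flips of a qubit -/

section Controlled

variable {ι : Type} [Fintype ι] [DecidableEq ι]

/-- The operator `(1 + E)/2 + (1 - E)/2 · X_a`, which flips the qubit `a` on the `-1`-eigenspace
of `E`. It is written as `(1 + X_a)/2 + E · (1 - X_a)/2`. -/
noncomputable def parityFlip (a : ι) (E : Op ι) : Op ι :=
  onQubit !![1 / 2, 1 / 2; 1 / 2, 1 / 2] a + E * onQubit !![1 / 2, -1 / 2; -1 / 2, 1 / 2] a

theorem onQubit_plus_add_minus (a : ι) :
    onQubit !![1 / 2, 1 / 2; 1 / 2, 1 / 2] a + onQubit !![1 / 2, -1 / 2; -1 / 2, 1 / 2] a = 1 := by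
  rw [← onQubit_add, ← onQubit_one a]
  congr 1
  ext i j
  fin_cases i <;> fin_cases j <;> norm_num

theorem onQubit_plus_sub_minus (a : ι) :
    onQubit !![1 / 2, 1 / 2; 1 / 2, 1 / 2] a - onQubit !![1 / 2, -1 / 2; -1 / 2, 1 / 2] a =
      onQubit Pauli.X.mat a := by
  rw [← onQubit_sub]
  congr 1
  ext i j
  fin_cases i <;> fin_cases j <;> norm_num [Pauli.mat]

theorem onQubit_plus_mul_plus (a : ι) :
    onQubit !![1 / 2, 1 / 2; 1 / 2, 1 / 2] a * onQubit !![1 / 2, 1 / 2; 1 / 2, 1 / 2] a =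
      onQubit !![1 / 2, 1 / 2; 1 / 2, 1 / 2] a := by
  rw [onQubit_mul]
  congr 1
  ext i j
  fin_cases i <;> fin_cases j <;> norm_num

theorem onQubit_minus_mul_minus (a : ι) :
    onQubit !![1 / 2, -1 / 2; -1 / 2, 1 / 2] a * onQubit !![1 / 2, -1 / 2; -1 / 2, 1 / 2] a =
      onQubit !![1 / 2, -1 / 2; -1 / 2, 1 / 2] a := by
  rw [onQubit_mul]
  congr 1
  ext i j
  fin_cases i <;> fin_cases j <;> norm_num

theorem onQubit_plus_mul_minus (a : ι) :
    onQubit !![1 / 2, 1 / 2; 1 / 2, 1 / 2] a * onQubit !![1 / 2, -1 / 2; -1 / 2, 1 / 2] a = 0 := by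
  rw [onQubit_mul, ← onQubit_zero a]
  congr 1
  ext i j
  fin_cases i <;> fin_cases j <;> norm_num

theorem onQubit_minus_mul_plus (a : ι) :
    onQubit !![1 / 2, -1 / 2; -1 / 2, 1 / 2] a * onQubit !![1 / 2, 1 / 2; 1 / 2, 1 / 2] a = 0 := by
  rw [onQubit_mul, ← onQubit_zero a]
  congr 1
  ext i j
  fin_cases i <;> fin_cases j <;> norm_num

theorem onQubit_Z_mul_plus (a : ι) :
    onQubit Pauli.Z.mat a * onQubit !![1 / 2, 1 / 2; 1 / 2, 1 / 2] a =
      onQubit !![1 / 2, -1 / 2; -1 / 2, 1 / 2] a * onQubit Pauli.Z.mat a := by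
  rw [onQubit_mul, onQubit_mul]
  congr 1
  ext i j
  fin_cases i <;> fin_cases j <;> norm_num [Pauli.mat]

theorem onQubit_Z_mul_minus (a : ι) :
    onQubit Pauli.Z.mat a * onQubit !![1 / 2, -1 / 2; -1 / 2, 1 / 2] a =
      onQubit !![1 / 2, 1 / 2; 1 / 2, 1 / 2] a * onQubit Pauli.Z.mat a := by
  rw [onQubit_mul, onQubit_mul]
  congr 1
  ext i j
  fin_cases i <;> fin_cases j <;> norm_num [Pauli.mat]

/-- `(1 ± X_a)/2` are orthogonal idempotents commuting with `E`, so the cross terms vanish.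
Multiplicativity lets a Pauli string be handled one tensor factor at a time. -/
theorem parityFlip_mul {a : ι} {D E : Op ι} (hE : ∀ u, Commute E (onQubit u a)) :
    parityFlip a D * parityFlip a E = parityFlip a (D * E) := by
  simp only [parityFlip, add_mul, mul_add]
  rw [onQubit_plus_mul_plus, mul_assoc D, onQubit_minus_mul_plus, ← mul_assoc _ E,
    ← (hE _).eq, mul_assoc E, onQubit_plus_mul_minus, mul_assoc D, ← mul_assoc _ E, ← (hE _).eq,
    mul_assoc E, onQubit_minus_mul_minus, mul_assoc D]
  simp

theorem parityFlip_one (a : ι) : parityFlip a 1 = 1 := by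
  rw [parityFlip, one_mul, onQubit_plus_add_minus]

theorem parityFlip_mul_self {a : ι} {E : Op ι} (hE : ∀ u, Commute E (onQubit u a))
    (hE2 : E * E = 1) : parityFlip a E * parityFlip a E = 1 := by
  rw [parityFlip_mul hE, hE2, parityFlip_one]

theorem conj_parityFlip {a : ι} {V V' E : Op ι} (hV' : ∀ u, Commute V' (onQubit u a))
    (h : V * V' = 1) : V * parityFlip a E * V' = parityFlip a (V * E * V') := by
  simp only [parityFlip, add_mul, mul_add, mul_assoc]
  rw [← (hV' _).eq, ← (hV' _).eq, ← mul_assoc V V', h, one_mul]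

/-- `Z_a` interchanges the projectors `(1 ± X_a)/2`; after moving it to the right, orthogonality
leaves `E` times their sum, which is `1`. -/
theorem parityFlip_conj_Z {a : ι} {E : Op ι} (hE : ∀ u, Commute E (onQubit u a)) :
    parityFlip a E * onQubit Pauli.Z.mat a * parityFlip a E = E * onQubit Pauli.Z.mat a := by
  have h : onQubit Pauli.Z.mat a * parityFlip a E =
      (onQubit !![1 / 2, -1 / 2; -1 / 2, 1 / 2] a +
        E * onQubit !![1 / 2, 1 / 2; 1 / 2, 1 / 2] a) * onQubit Pauli.Z.mat a := by
    rw [parityFlip, mul_add, onQubit_Z_mul_plus, ← mul_assoc, ← (hE _).eq, mul_assoc E,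
      onQubit_Z_mul_minus, add_mul, mul_assoc E]
  rw [mul_assoc, h, ← mul_assoc]
  congr 1
  rw [parityFlip, add_mul, mul_add, mul_add, onQubit_plus_mul_minus, ← mul_assoc _ E,
    ← (hE _).eq, mul_assoc E, onQubit_plus_mul_plus, mul_assoc E, onQubit_minus_mul_minus,
    mul_assoc E, ← mul_assoc _ E, ← (hE _).eq, mul_assoc E, onQubit_minus_mul_plus, mul_zero,
    mul_zero, zero_add, add_zero, ← mul_add, onQubit_plus_add_minus, mul_one]

theorem parityFlip_Z {a i : ι} (h : i ≠ a) :
    parityFlip a (onQubit Pauli.Z.mat i) = (Gate.CNOT i a h).mat := by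
  have h1 : (1 : Op ι) = onQubit !![1, 0; 0, 0] i + onQubit !![0, 0; 0, 1] i := by
    rw [← onQubit_add, ← onQubit_one i]
    congr 1
    ext i j
    fin_cases i <;> fin_cases j <;> norm_num
  have h2 : onQubit Pauli.Z.mat i = onQubit !![1, 0; 0, 0] i - onQubit !![0, 0; 0, 1] i := by
    rw [← onQubit_sub]
    congr 1
    ext i j
    fin_cases i <;> fin_cases j <;> norm_num [Pauli.mat]
  have h3 : onQubit !![1, 0; 0, 0] i = onQubit !![1, 0; 0, 0] i *
      (onQubit !![1 / 2, 1 / 2; 1 / 2, 1 / 2] a + onQubit !![1 / 2, -1 / 2; -1 / 2, 1 / 2] a) := by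
    rw [onQubit_plus_add_minus, mul_one]
  rw [Gate.mat, parityFlip, h2, ← onQubit_plus_sub_minus]
  nth_rw 2 [h3]
  nth_rw 1 [← one_mul (onQubit !![1 / 2, 1 / 2; 1 / 2, 1 / 2] a), h1]
  noncomm_ring

/-- For `Z` the flip is a CNOT; conjugating the control qubit by `H`, then by `S`, gives `X`, then
`Y`. -/
theorem isCliffordOp_parityFlip_onQubit {a i : ι} (h : i ≠ a) (σ : Pauli) :
    IsCliffordOp (parityFlip a (onQubit σ.mat i)) := by
  have hZ : IsCliffordOp (parityFlip a (onQubit Pauli.Z.mat i)) :=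
    parityFlip_Z h ▸ isCliffordOp_gate trivial
  have hX : IsCliffordOp (parityFlip a (onQubit Pauli.X.mat i)) := by
    rw [← hadamard_conj_Z, ← onQubit_mul, ← onQubit_mul,
      ← conj_parityFlip (fun u => onQubit_commute h _ _)]
    · exact ((isCliffordOp_H i).mul hZ).mul (isCliffordOp_H i)
    · rw [onQubit_mul, hadamard_mul_self, onQubit_one]
  cases σ with
  | I =>
    have : Pauli.I.mat = 1 := Matrix.one_fin_two.symm
    rw [this, onQubit_one, parityFlip_one]
    exact isCliffordOp_one
  | X => exact hX
  | Y =>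
    rw [← phase_conj_X, ← onQubit_mul, ← onQubit_mul,
      ← conj_parityFlip (fun u => onQubit_commute h _ _)]
    · rw [← onQubit_mul]
      exact ((isCliffordOp_S i).mul hX).mul ((isCliffordOp_S i).mul (isCliffordOp_Z i))
    · rw [onQubit_mul, phase_mul_inv, onQubit_one]
  | Z => exact hZ

theorem isCliffordOp_parityFlip_tensor {a : ι} {B : ι → Pauli} (hB : B a = .I) :
    IsCliffordOp (parityFlip a (tensor fun i => (B i).mat)) := by
  have hI : Pauli.I.mat = 1 := Matrix.one_fin_two.symm
  suffices h : ∀ s : Finset ι,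
      IsCliffordOp (parityFlip a (tensor fun i => if i ∈ s then (B i).mat else 1)) by
    simpa using h Finset.univ
  intro s
  induction s using Finset.induction_on with
  | empty =>
    simp only [Finset.notMem_empty, if_false, tensor_one, parityFlip_one]
    exact isCliffordOp_one
  | insert i s hi ih =>
    have hmul : (tensor fun j => if j ∈ insert i s then (B j).mat else 1) =
        onQubit (B i).mat i * tensor fun j => if j ∈ s then (B j).mat else 1 := by
      rw [onQubit, tensor_mul]
      congr 1
      funext j
      rcases eq_or_ne j i with rfl | hj
      · simp [hi]
      · simp [hj]
    rw [hmul, ← parityFlip_mul]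
    · refine IsCliffordOp.mul ?_ ih
      rcases eq_or_ne i a with rfl | hia
      · rw [hB, hI, onQubit_one, parityFlip_one]
        exact isCliffordOp_one
      · exact isCliffordOp_parityFlip_onQubit hia _
    · intro u
      refine tensor_commute_onQubit ?_
      simp [hB, hI]

theorem SignedPauli.commute_onQubit {P : SignedPauli ι} {a : ι} (h : P.axes a = .I)
    (u : Matrix (Fin 2) (Fin 2) ℂ) : Commute P.mat (onQubit u a) := by
  have hI : Pauli.I.mat = 1 := Matrix.one_fin_two.symm
  refine Commute.smul_left (tensor_commute_onQubit ?_) _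
  simp [h, hI]

theorem SignedPauli.isCliffordOp_parityFlip {P : SignedPauli ι} {a : ι} (h : P.axes a = .I) :
    IsCliffordOp (parityFlip a P.mat) := by
  rcases Int.units_eq_one_or P.sign with hs | hs
  · simpa [SignedPauli.mat, hs] using isCliffordOp_parityFlip_tensor h
  -- A negative sign costs one unconditional flip `X_a`.
  · have hX : parityFlip a (-1) = onQubit Pauli.X.mat a := by
      rw [parityFlip, neg_one_mul, ← sub_eq_add_neg, onQubit_plus_sub_minus]
    have hP : P.mat = -1 * tensor fun i => (P.axes i).mat := by
      simp [SignedPauli.mat, hs]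
    have hI : Pauli.I.mat = 1 := Matrix.one_fin_two.symm
    rw [hP, ← parityFlip_mul, hX]
    · exact (isCliffordOp_X a).mul (isCliffordOp_parityFlip_tensor h)
    · intro u
      exact tensor_commute_onQubit (by simp [h, hI])

end Controlled

/-! ### Commutation and invertibility of gates -/

section Circuits

variable {ι : Type}

theorem Circuit.IsClifford.append {L M : Circuit ι} (hL : L.IsClifford) (hM : M.IsClifford) :
    Circuit.IsClifford (L ++ M) := by
  intro g hg
  rcases List.mem_append.1 hg with hg | hg
  exacts [hL g hg, hM g hg]

theorem Gate.isClifford_or (g : Gate ι) : g.IsClifford ∨ ∃ q, g = .T q := by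
  cases g <;> simp [Gate.IsClifford]

variable [Fintype ι] [DecidableEq ι]

theorem Circuit.mat_append (L M : Circuit ι) :
    Circuit.mat (L ++ M) = Circuit.mat L * Circuit.mat M := by
  simp [Circuit.mat]

theorem Circuit.mat_cons (g : Gate ι) (L : Circuit ι) :
    Circuit.mat (g :: L) = g.mat * Circuit.mat L := by
  simp [Circuit.mat]

theorem Gate.commute_onQubit {g : Gate ι} {q : ι} (h : q ∉ g.qubits)
    (u : Matrix (Fin 2) (Fin 2) ℂ) : Commute g.mat (onQubit u q) := by
  cases g with
  | H p => exact onQubit_commute (Ne.symm h) _ _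
  | S p => exact onQubit_commute (Ne.symm h) _ _
  | T p => exact onQubit_commute (Ne.symm h) _ _
  | CNOT c t hct =>
    have hc : c ≠ q := fun e => h (Or.inl e.symm)
    have ht : t ≠ q := fun e => h (Or.inr e.symm)
    exact (onQubit_commute hc _ _).add_left
      ((onQubit_commute hc _ _).mul_left (onQubit_commute ht _ _))

theorem Gate.commute_of_disjoint {g h : Gate ι} (hd : Disjoint g.qubits h.qubits) :
    Commute g.mat h.mat := by
  have key : ∀ q ∈ h.qubits, ∀ u, Commute g.mat (onQubit u q) := fun q hq u =>
    g.commute_onQubit (fun hq' => Set.disjoint_left.1 hd hq' hq) u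
  cases h with
  | H p => exact key p rfl _
  | S p => exact key p rfl _
  | T p => exact key p rfl _
  | CNOT c t hct =>
    have hc := key c (Or.inl rfl)
    have ht := key t (Or.inr rfl)
    exact (hc _).add_right ((hc _).mul_right (ht _))

theorem Gate.isUnit_mat {g : Gate ι} (hg : g.IsClifford) : IsUnit g.mat := by
  cases g with
  | H p =>
    refine IsUnit.of_mul_eq_one
      (onQubit (((1 / Real.sqrt 2 : ℝ) : ℂ) • !![1, 1; 1, -1]) p) ?_
    rw [Gate.mat, onQubit_mul, hadamard_mul_self, onQubit_one]
  | S p =>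
    refine IsUnit.of_mul_eq_one (onQubit (!![1, 0; 0, Complex.I] * Pauli.Z.mat) p) ?_
    rw [Gate.mat, onQubit_mul, phase_mul_inv, onQubit_one]
  | T p => exact hg.elim
  | CNOT c t hct =>
    refine IsUnit.of_mul_eq_one (parityFlip t (onQubit Pauli.Z.mat c)) ?_
    rw [← parityFlip_Z hct, parityFlip_mul_self (fun u => onQubit_commute hct _ _)]
    rw [onQubit_mul, Pauli.mat_mul_self, onQubit_one]

end Circuits

/-! ### The rotation axes of the `T` gates of a circuit -/

section Axes

variable {ι : Type} [Fintype ι] [DecidableEq ι]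

/-- The unitary of a gate, with `T` gates replaced by the identity. -/
noncomputable def Gate.cliffordPart : Gate ι → Op ι
  | .T _ => 1
  | g => g.mat

/-- The rotation axis `C Z_q C⁻¹` of a `T` gate preceded by the Clifford `C` in the product. -/
noncomputable def Gate.axis (C : Op ι) : Gate ι → List (Op ι)
  | .T q => [C * onQubit Pauli.Z.mat q * C⁻¹]
  | _ => []

/-- The product of the Clifford gates of a circuit. -/
noncomputable def Circuit.cliffordPart (L : Circuit ι) : Op ι := (L.map Gate.cliffordPart).prod

/-- The rotation axes of the `T` gates of a circuit multiplied by the Clifford `C` from the left,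
in the form `∏ R(Eⱼ) · D` with `D` Clifford. -/
noncomputable def Circuit.axes (C : Op ι) : Circuit ι → List (Op ι)
  | [] => []
  | g :: L => g.axis C ++ Circuit.axes (C * g.cliffordPart) L

theorem Gate.cliffordPart_of_isClifford {g : Gate ι} (hg : g.IsClifford) :
    g.cliffordPart = g.mat := by
  cases g <;> first | rfl | exact hg.elim

theorem Gate.axis_of_isClifford {g : Gate ι} (hg : g.IsClifford) (C : Op ι) : g.axis C = [] := by
  cases g <;> first | rfl | exact hg.elim

theorem Circuit.cliffordPart_append (L M : Circuit ι) :
    Circuit.cliffordPart (L ++ M) = Circuit.cliffordPart L * Circuit.cliffordPart M := by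
  simp [Circuit.cliffordPart]

theorem Circuit.IsClifford.cliffordPart_eq {L : Circuit ι} (hL : L.IsClifford) :
    L.cliffordPart = L.mat := by
  rw [Circuit.cliffordPart, Circuit.mat]
  congr 1
  exact List.map_congr_left fun g hg => Gate.cliffordPart_of_isClifford (hL g hg)

theorem Circuit.cliffordPart_map_T (qs : List ι) :
    Circuit.cliffordPart (qs.map Gate.T) = 1 := by
  induction qs with
  | nil => rfl
  | cons q qs ih =>
    rw [Circuit.cliffordPart] at ih
    rw [Circuit.cliffordPart, List.map_cons, List.map_cons, List.prod_cons, ih, mul_one]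
    rfl

theorem Circuit.axes_append (C : Op ι) (L M : Circuit ι) :
    Circuit.axes C (L ++ M) =
      Circuit.axes C L ++ Circuit.axes (C * Circuit.cliffordPart L) M := by
  induction L generalizing C with
  | nil => simp [Circuit.axes, Circuit.cliffordPart]
  | cons g L ih => simp [Circuit.axes, ih, Circuit.cliffordPart, mul_assoc]

theorem Circuit.IsClifford.axes_eq {L : Circuit ι} (hL : L.IsClifford) (C : Op ι) :
    Circuit.axes C L = [] := by
  induction L generalizing C with
  | nil => rfl
  | cons g L ih =>
    rw [Circuit.axes, Gate.axis_of_isClifford (hL g List.mem_cons_self),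
      ih fun g hg => hL g (List.mem_cons_of_mem _ hg)]
    rfl

theorem Circuit.axes_map_T (C : Op ι) (qs : List ι) :
    Circuit.axes C (qs.map Gate.T) = qs.map fun q => C * onQubit Pauli.Z.mat q * C⁻¹ := by
  induction qs with
  | nil => rfl
  | cons q qs ih => simp [Circuit.axes, Gate.axis, Gate.cliffordPart, ih]

theorem commute_conj_Z (C : Op ι) (p q : ι) :
    Commute (C * onQubit Pauli.Z.mat p * C⁻¹) (C * onQubit Pauli.Z.mat q * C⁻¹) := by
  by_cases hC : IsUnit C.det
  · have h : Commute (onQubit Pauli.Z.mat p) (onQubit Pauli.Z.mat q) := by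
      rcases eq_or_ne p q with rfl | hpq
      exacts [Commute.refl _, onQubit_commute hpq _ _]
    have key : ∀ D E : Op ι, C * D * C⁻¹ * (C * E * C⁻¹) = C * (D * E) * C⁻¹ := fun D E => by
      simp only [mul_assoc, Matrix.nonsing_inv_mul_cancel_left _ _ hC]
    rw [commute_iff_eq, key, key, h.eq]
  -- For singular `C` the matrix inverse is `0` by convention, so both sides vanish and no
  -- invertibility hypothesis is needed.
  · rw [Matrix.nonsing_inv_apply_not_isUnit _ hC]
    simp

/-- A Clifford gate away from `q` commutes with `Z_q` and cancels in the conjugation; a `T` gate has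
Clifford part `1`. -/
theorem Gate.axis_mul_cliffordPart {g h : Gate ι} (hd : Disjoint g.qubits h.qubits) (C : Op ι) :
    h.axis (C * g.cliffordPart) = h.axis C := by
  rcases h.isClifford_or with hh | ⟨q, rfl⟩
  · rw [Gate.axis_of_isClifford hh, Gate.axis_of_isClifford hh]
  · rcases g.isClifford_or with hg | ⟨p, rfl⟩
    · have hq : q ∉ g.qubits := fun hq => Set.disjoint_left.1 hd hq rfl
      have hu : IsUnit g.mat.det := (Matrix.isUnit_iff_isUnit_det _).1 (Gate.isUnit_mat hg)
      rw [Gate.cliffordPart_of_isClifford hg, Gate.axis, Gate.axis, Matrix.mul_inv_rev,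
        mul_assoc C, (Gate.commute_onQubit hq _).eq, mul_assoc C, mul_assoc C, mul_assoc,
        Matrix.mul_nonsing_inv_cancel_left _ _ hu]
    · simp [Gate.cliffordPart]

theorem Gate.cliffordPart_commute {g h : Gate ι} (hd : Disjoint g.qubits h.qubits) :
    Commute g.cliffordPart h.cliffordPart := by
  rcases g.isClifford_or with hg | ⟨p, rfl⟩
  · rcases h.isClifford_or with hh | ⟨q, rfl⟩
    · rw [Gate.cliffordPart_of_isClifford hg, Gate.cliffordPart_of_isClifford hh]
      exact Gate.commute_of_disjoint hd
    · exact Commute.one_right _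
  · exact Commute.one_left _

/-- Sliding gates past each other only exchanges `T` gates with commuting axes. -/
theorem Circuit.Slide.axes {L L' : Circuit ι} (h : Circuit.Slide L L') (C : Op ι) :
    Relation.ReflTransGen (AdjSwap Commute) (Circuit.axes C L) (Circuit.axes C L') := by
  cases h with
  | mk L₁ L₂ g h hd =>
    rw [Circuit.axes_append, Circuit.axes_append]
    refine reflTransGen_append_left ?_ _
    generalize C * Circuit.cliffordPart L₁ = D
    simp only [Circuit.axes]
    rw [Gate.axis_mul_cliffordPart hd, Gate.axis_mul_cliffordPart hd.symm, mul_assoc, mul_assoc,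
      (Gate.cliffordPart_commute hd).eq]
    rcases g.isClifford_or with hg | ⟨p, rfl⟩
    · rw [Gate.axis_of_isClifford hg]
      rfl
    · rcases h.isClifford_or with hh | ⟨q, rfl⟩
      · rw [Gate.axis_of_isClifford hh]
        rfl
      · exact .single (.mk [] _ _ _ (commute_conj_Z D p q))

theorem Circuit.axes_reflTransGen_slide {L L' : Circuit ι}
    (h : Relation.ReflTransGen Circuit.Slide L L') (C : Op ι) :
    Relation.ReflTransGen (AdjSwap Commute) (Circuit.axes C L) (Circuit.axes C L') := by
  induction h with
  | refl => exact .refl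
  | tail _ h ih => exact ih.trans (h.axes C)

/-- All `T` gates of a cycle are preceded by the same Clifford, so their axes are conjugates of
various `Z_q` by one operator. -/
theorem Circuit.Layered.axes {L : Circuit ι} {d : ℕ} (h : Circuit.Layered L d) (C : Op ι) :
    ∃ gs : List (List (Op ι)), gs.length = d ∧ Circuit.axes C L = gs.flatten ∧
      ∀ g ∈ gs, g.Pairwise Commute := by
  induction h generalizing C with
  | clifford K hK => exact ⟨[], rfl, hK.axes_eq C, by simp⟩
  | cycle K hK qs hqs L d hL ih =>
    obtain ⟨gs, rfl, hax, hgs⟩ := ih (C * K.mat)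
    refine ⟨(qs.map fun q => C * K.mat * onQubit Pauli.Z.mat q * (C * K.mat)⁻¹) :: gs, rfl, ?_, ?_⟩
    · rw [Circuit.axes_append, Circuit.axes_append, hK.axes_eq, Circuit.cliffordPart_append,
        hK.cliffordPart_eq, Circuit.cliffordPart_map_T, mul_one, hax, Circuit.axes_map_T]
      rfl
    · refine List.forall_mem_cons.2 ⟨?_, hgs⟩
      rw [List.pairwise_map]
      exact List.pairwise_of_forall fun p q => commute_conj_Z _ p q

theorem Circuit.HasTCycles.le_of_hasChain {L : Circuit ι} {d k : ℕ} (h : L.HasTCycles d)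
    {C : Op ι} (hk : HasChain Commute (Circuit.axes C L) k) : k ≤ d := by
  obtain ⟨L', hs, hL'⟩ := h
  obtain ⟨gs, rfl, hax, hgs⟩ := hL'.axes C
  have := hasChain_of_reflTransGen (Circuit.axes_reflTransGen_slide hs C) hk
  rw [hax] at this
  exact this.le_length hgs

end Axes

/-! ### Ancilla qubits -/

section Ancillas

variable {n t : ℕ}

/-- The operator `A ⊗ B` on a register with ancilla qubits. -/
def tensorAncilla (A : Op (Fin n)) (B : Op (Fin t)) : Op (Fin n ⊕ Fin t) :=
  Matrix.of fun x y => A (x ∘ Sum.inl) (y ∘ Sum.inl) * B (x ∘ Sum.inr) (y ∘ Sum.inr)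

theorem extendOp_eq (C : Op (Fin n)) : extendOp t C = tensorAncilla C 1 := rfl

theorem tensorAncilla_mul (A A' : Op (Fin n)) (B B' : Op (Fin t)) :
    tensorAncilla A B * tensorAncilla A' B' = tensorAncilla (A * A') (B * B') := by
  ext x y
  simp only [tensorAncilla, Matrix.mul_apply, Matrix.of_apply, Finset.sum_mul_sum]
  rw [← (Equiv.sumArrowEquivProdArrow (Fin n) (Fin t) (Fin 2)).symm.sum_comp,
    Fintype.sum_prod_type]
  refine Finset.sum_congr rfl fun u _ => Finset.sum_congr rfl fun v _ => ?_
  have hu : (Equiv.sumArrowEquivProdArrow (Fin n) (Fin t) (Fin 2)).symm (u, v) ∘ Sum.inl = u := rfl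
  have hv : (Equiv.sumArrowEquivProdArrow (Fin n) (Fin t) (Fin 2)).symm (u, v) ∘ Sum.inr = v := rfl
  rw [hu, hv]
  ring

/-- The condition `hB` on the zeroth column says that `B` fixes `|0⟩`. -/
theorem tensorAncilla_mulVec (A : Op (Fin n)) {B : Op (Fin t)}
    (hB : ∀ x, B x 0 = if x = 0 then 1 else 0) (ψ : (Fin n → Fin 2) → ℂ) :
    tensorAncilla A B *ᵥ withAncillas t ψ = withAncillas t (A *ᵥ ψ) := by
  ext x
  simp only [tensorAncilla, Matrix.mulVec, dotProduct, Matrix.of_apply, withAncillas]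
  rw [← (Equiv.sumArrowEquivProdArrow (Fin n) (Fin t) (Fin 2)).symm.sum_comp,
    Fintype.sum_prod_type]
  have key : ∀ u v, (Equiv.sumArrowEquivProdArrow (Fin n) (Fin t) (Fin 2)).symm (u, v) ∘ Sum.inl = u
      ∧ (Equiv.sumArrowEquivProdArrow (Fin n) (Fin t) (Fin 2)).symm (u, v) ∘ Sum.inr = v :=
    fun _ _ => ⟨rfl, rfl⟩
  simp only [key, mul_ite, mul_zero, Finset.sum_ite_eq', Finset.mem_univ, if_true, hB]
  split_ifs <;> simp

theorem tensor_elim (A : Fin n → Matrix (Fin 2) (Fin 2) ℂ)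
    (B : Fin t → Matrix (Fin 2) (Fin 2) ℂ) :
    tensor (Sum.elim A B) = tensorAncilla (tensor A) (tensor B) := by
  ext x y
  simp [tensor, tensorAncilla, Fintype.prod_sum_type]

theorem SignedPauli.extend_mat (P : SignedPauli (Fin n)) (Q : Fin t → Pauli) :
    (P.extend Q).mat = tensorAncilla P.mat (tensor fun a => (Q a).mat) := by
  have h : (fun i => ((P.extend Q).axes i).mat) =
      Sum.elim (fun i => (P.axes i).mat) fun a => (Q a).mat := by
    funext i
    cases i <;> rfl
  rw [SignedPauli.mat, h, tensor_elim, SignedPauli.mat]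
  ext x y
  simp [tensorAncilla, SignedPauli.extend, mul_assoc]

theorem tensor_apply_zero {Q : Fin t → Pauli} (hQ : ∀ a, Q a = Pauli.I ∨ Q a = Pauli.Z)
    (x : Fin t → Fin 2) : tensor (fun a => (Q a).mat) x 0 = if x = 0 then 1 else 0 := by
  have h : ∀ a i, (Q a).mat i 0 = if i = 0 then 1 else 0 := by
    intro a i
    rcases hQ a with h | h <;> fin_cases i <;> simp [h, Pauli.mat]
  simp only [tensor, Matrix.of_apply, Pi.zero_apply, h]
  split_ifs with hx
  · simp [hx]
  · obtain ⟨i, hi⟩ := Function.ne_iff.1 hx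
    exact Finset.prod_eq_zero (Finset.mem_univ i) (if_neg hi)

/-- The `(0, 0)` entries of `Q Q'` and `Q' Q` are `1`, so that ancilla block of the commutation
relation is the one for `P` and `P'`. Diagonality matters: `X ⊗ X` and `Z ⊗ Z` commute. -/
theorem SignedPauli.commute_of_extend {P P' : SignedPauli (Fin n)} {Q Q' : Fin t → Pauli}
    (hQ : ∀ a, Q a = Pauli.I ∨ Q a = Pauli.Z) (hQ' : ∀ a, Q' a = Pauli.I ∨ Q' a = Pauli.Z)
    (h : Commute (P.extend Q).mat (P'.extend Q').mat) : Commute P.mat P'.mat := by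
  have hz : ∀ {Q Q' : Fin t → Pauli}, (∀ a, Q a = Pauli.I ∨ Q a = Pauli.Z) →
      (∀ a, Q' a = Pauli.I ∨ Q' a = Pauli.Z) →
      (tensor (fun a => (Q a).mat) * tensor fun a => (Q' a).mat) 0 0 = 1 := by
    intro Q Q' hQ hQ'
    simp [Matrix.mul_apply, tensor_apply_zero hQ']
    simp [tensor_apply_zero hQ]
  rw [commute_iff_eq, SignedPauli.extend_mat, SignedPauli.extend_mat, tensorAncilla_mul,
    tensorAncilla_mul] at h
  ext x y
  have := congrFun (congrFun h (Sum.elim x 0)) (Sum.elim y 0)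
  simpa [tensorAncilla, hz hQ hQ', hz hQ' hQ] using this

end Ancillas

/-! ### Translated layers -/

section Layers

variable {n t : ℕ}

/-- As `A A' = 1`, a block has trivial Clifford part, so it does not alter the axes of later blocks.
-/
theorem IsTLayerOf.axes {Ps : List (SignedPauli (Fin n))} {B : Circuit (Fin n ⊕ Fin t)}
    (h : IsTLayerOf Ps B) : Circuit.cliffordPart B = 1 ∧
      List.Forall₂ (fun P E => ∃ Q : Fin t → Pauli, (∀ a, Q a = Pauli.I ∨ Q a = Pauli.Z) ∧
        E = (P.extend Q).mat) Ps (Circuit.axes 1 B) := by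
  obtain ⟨-, A, A', qs, hA, hA', hAA', -, hP, rfl⟩ := h
  rw [Circuit.axes_append, Circuit.axes_append, hA.axes_eq, hA'.axes_eq, Circuit.axes_map_T,
    Circuit.cliffordPart_append, Circuit.cliffordPart_append, Circuit.cliffordPart_map_T,
    hA.cliffordPart_eq, hA'.cliffordPart_eq, mul_one, hAA', one_mul, Matrix.inv_eq_right_inv hAA',
    List.append_nil, List.nil_append, List.forall₂_map_right_iff]
  exact ⟨rfl, hP.imp fun P q ⟨Q, hQ, h⟩ => ⟨Q, hQ, h⟩⟩

theorem forall₂_axes_of_layers {groups : List (List (SignedPauli (Fin n)))}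
    {blocks : List (Circuit (Fin n ⊕ Fin t))} (h : List.Forall₂ IsTLayerOf groups blocks)
    {K : Circuit (Fin n ⊕ Fin t)} (hK : K.IsClifford) :
    List.Forall₂ (fun P E => ∃ Q : Fin t → Pauli, (∀ a, Q a = Pauli.I ∨ Q a = Pauli.Z) ∧
        E = (P.extend Q).mat) groups.flatten (Circuit.axes 1 (blocks.flatten ++ K)) := by
  induction h with
  | nil =>
    rw [List.flatten_nil, List.flatten_nil, List.nil_append, hK.axes_eq]
    exact .nil
  | cons hB _ ih =>
    rw [List.flatten_cons, List.flatten_cons, List.append_assoc, Circuit.axes_append,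
      hB.axes.1, mul_one]
    exact List.rel_append hB.axes.2 ih

/-- A chain of non-commuting rotations bounds the T-depth of every derived circuit. -/
theorem Derives.le_tDepth {U : RotationForm n} {W : Circuit (Fin n ⊕ Fin t)} (h : Derives U t W)
    {k : ℕ} (hk : HasChain (fun P Q : SignedPauli (Fin n) => Commute P.mat Q.mat) U.paulis k) :
    k ≤ W.tDepth := by
  obtain ⟨groups, blocks, K, hs, hl, hK, -, rfl⟩ := h
  have hs' := Relation.ReflTransGen.mono (fun _ _ h => commSwap_iff.1 h) _ _ hs
  -- The infimum is attained because some grouping exists; an empty set would give the default value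
  -- `0`.
  have hT : Circuit.HasTCycles (blocks.flatten ++ K) (Circuit.tDepth (blocks.flatten ++ K)) :=
    Nat.sInf_mem (Circuit.exists_hasTCycles _)
  refine hT.le_of_hasChain (C := 1)
    ((hasChain_of_reflTransGen hs' hk).of_forall₂ ?_ (forall₂_axes_of_layers hl hK))
  rintro P _ P' _ ⟨Q, hQ, rfl⟩ ⟨Q', hQ', rfl⟩ hc
  exact SignedPauli.commute_of_extend hQ hQ' hc

/-- The closing Clifford `A'` merges into the leading Clifford part of what follows, so a block
costs a single T-cycle. -/
theorem IsTLayerOf.layered {Ps : List (SignedPauli (Fin n))} {B L : Circuit (Fin n ⊕ Fin t)}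
    {d : ℕ} (h : IsTLayerOf Ps B) (hL : Circuit.Layered L d) :
    Circuit.Layered (B ++ L) (d + 1) := by
  obtain ⟨-, A, A', qs, hA, hA', -, hqs, -, rfl⟩ := h
  rw [List.append_assoc]
  refine .cycle A hA qs hqs _ d ?_
  cases hL with
  | clifford K hK => exact .clifford _ (hA'.append hK)
  | cycle K hK qs hqs L d hL =>
    rw [← List.append_assoc, ← List.append_assoc]
    exact .cycle _ (hA'.append hK) qs hqs L d hL

theorem layered_of_layers {groups : List (List (SignedPauli (Fin n)))}
    {blocks : List (Circuit (Fin n ⊕ Fin t))} (h : List.Forall₂ IsTLayerOf groups blocks)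
    {K : Circuit (Fin n ⊕ Fin t)} (hK : K.IsClifford) :
    Circuit.Layered (blocks.flatten ++ K) groups.length := by
  induction h with
  | nil => exact .clifford _ hK
  | cons hB _ ih =>
    rw [List.flatten_cons, List.append_assoc]
    exact hB.layered ih

end Layers

/-! ### Derived circuits implement the given unitary -/

section Implementation

variable {n t : ℕ}

theorem mat_T {ι : Type} [Fintype ι] [DecidableEq ι] (q : ι) :
    (Gate.T q).mat = ((1 + omega) / 2) • (1 : Op ι) +
      ((1 - omega) / 2) • onQubit Pauli.Z.mat q := by
  rw [Gate.mat, ← onQubit_one q, ← onQubit_smul, ← onQubit_smul, ← onQubit_add]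
  congr 1
  ext i j
  fin_cases i <;> fin_cases j <;> simp [Pauli.mat] <;> ring

theorem SignedPauli.rot_extend_mulVec (P : SignedPauli (Fin n)) {Q : Fin t → Pauli}
    (hQ : ∀ a, Q a = Pauli.I ∨ Q a = Pauli.Z) (ψ : (Fin n → Fin 2) → ℂ) :
    (P.extend Q).rot *ᵥ withAncillas t ψ = withAncillas t (P.rot *ᵥ ψ) := by
  rw [SignedPauli.rot, SignedPauli.rot, Matrix.add_mulVec, Matrix.add_mulVec,
    Matrix.smul_mulVec, Matrix.smul_mulVec, Matrix.smul_mulVec, Matrix.smul_mulVec,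
    SignedPauli.extend_mat, tensorAncilla_mulVec _ (tensor_apply_zero hQ), Matrix.one_mulVec,
    Matrix.one_mulVec]
  ext x
  simp only [withAncillas, Pi.add_apply, Pi.smul_apply, smul_eq_mul]
  split_ifs <;> simp

theorem IsTLayerOf.mulVec {Ps : List (SignedPauli (Fin n))} {B : Circuit (Fin n ⊕ Fin t)}
    (h : IsTLayerOf Ps B) (ψ : (Fin n → Fin 2) → ℂ) :
    B.mat *ᵥ withAncillas t ψ = withAncillas t ((Ps.map SignedPauli.rot).prod *ᵥ ψ) := by
  obtain ⟨-, A, A', qs, -, -, hAA', -, hP, rfl⟩ := h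
  have hA'A : A'.mat * A.mat = 1 := mul_eq_one_comm.1 hAA'
  induction hP generalizing ψ with
  | nil => rw [List.map_nil, List.append_nil, Circuit.mat_append, hAA']; simp
  | @cons P q Ps qs hPq _ ih =>
    obtain ⟨Q, hQ, hPq⟩ := hPq
    have hrot : A.mat * (Gate.T q).mat * A'.mat = (P.extend Q).rot := by
      rw [mat_T, SignedPauli.rot, ← hPq, mul_add, add_mul, mul_smul_comm, mul_smul_comm,
        smul_mul_assoc, smul_mul_assoc, mul_one, hAA']
    -- Inserting `A' A = 1` after the first `T` gate splits off one conjugated rotation.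
    have hmat : Circuit.mat (A ++ (q :: qs).map Gate.T ++ A') =
        (P.extend Q).rot * Circuit.mat (A ++ qs.map Gate.T ++ A') := by
      rw [← hrot, List.map_cons]
      simp only [Circuit.mat_append, Circuit.mat_cons]
      simp only [mul_assoc]
      rw [← mul_assoc A'.mat, hA'A, one_mul]
    rw [hmat, ← Matrix.mulVec_mulVec, ih, SignedPauli.rot_extend_mulVec _ hQ, List.map_cons,
      List.prod_cons, Matrix.mulVec_mulVec]

theorem layers_mulVec {groups : List (List (SignedPauli (Fin n)))}
    {blocks : List (Circuit (Fin n ⊕ Fin t))} (h : List.Forall₂ IsTLayerOf groups blocks)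
    (ψ : (Fin n → Fin 2) → ℂ) :
    Circuit.mat blocks.flatten *ᵥ withAncillas t ψ =
      withAncillas t ((groups.flatten.map SignedPauli.rot).prod *ᵥ ψ) := by
  induction h with
  | nil => simp [Circuit.mat]
  | cons hB _ ih =>
    rw [List.flatten_cons, List.flatten_cons, Circuit.mat_append, ← Matrix.mulVec_mulVec, ih,
      hB.mulVec, List.map_append, List.prod_append, Matrix.mulVec_mulVec]

theorem SignedPauli.rot_commute {ι : Type} [Fintype ι] [DecidableEq ι] {P Q : SignedPauli ι}
    (h : Commute P.mat Q.mat) : Commute P.rot Q.rot := by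
  have h1 : ∀ (c : ℂ) (M : Op ι), Commute (c • (1 : Op ι)) M :=
    fun c M => (Commute.one_left M).smul_left c
  exact (h1 _ _).add_left (((h1 _ _).symm).add_right ((h.smul_left _).smul_right _))

theorem prod_rot_eq {l l' : List (SignedPauli (Fin n))}
    (h : Relation.ReflTransGen CommSwap l l') :
    (l.map SignedPauli.rot).prod = (l'.map SignedPauli.rot).prod := by
  induction h with
  | refl => rfl
  | tail _ h ih =>
    rw [ih]
    cases h with
    | mk l₁ l₂ P Q hc =>
      simp only [List.map_append, List.map_cons, List.prod_append, List.prod_cons]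
      rw [← mul_assoc P.rot, (SignedPauli.rot_commute hc).eq, mul_assoc]

theorem Derives.implements {U : RotationForm n} {W : Circuit (Fin n ⊕ Fin t)}
    (h : Derives U t W) : Implements W U := by
  obtain ⟨groups, blocks, K, hs, hl, -, hK, rfl⟩ := h
  -- The scalar `e^{-iφ}` cancels the phase of `U`, which the circuit does not reproduce.
  refine ⟨Complex.exp (Complex.I * ↑(-U.phase)), Complex.norm_exp_I_mul_ofReal _, fun ψ => ?_⟩
  have hone : ∀ x : Fin t → Fin 2, (1 : Op (Fin t)) x 0 = if x = 0 then 1 else 0 :=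
    fun x => Matrix.one_apply
  have hsmul : ∀ (c : ℂ) (φ : (Fin n → Fin 2) → ℂ),
      withAncillas t (c • φ) = c • withAncillas t φ := fun c φ => by
    ext x
    simp [withAncillas]
  rw [Circuit.mat_append, ← Matrix.mulVec_mulVec, hK, extendOp_eq, tensorAncilla_mulVec _ hone,
    layers_mulVec hl, RotationForm.mat, Matrix.smul_mulVec, hsmul, smul_smul, ← Complex.exp_add,
    prod_rot_eq hs, Matrix.mulVec_mulVec]
  simp

end Implementation

/-! ### Layering a commuting group with ancillas -/

section Construction

variable {n t : ℕ}

theorem SignedPauli.extend_update_mat (P : SignedPauli (Fin n)) (a : Fin t) :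
    (P.extend (Function.update (fun _ => .I) a .Z)).mat =
      (P.extend fun _ => .I).mat * onQubit Pauli.Z.mat (Sum.inr a) := by
  rw [SignedPauli.mat, SignedPauli.mat, smul_mul_assoc, onQubit, tensor_mul]
  congr 2
  funext i
  have hI : Pauli.I.mat = 1 := Matrix.one_fin_two.symm
  rcases i with i | b
  · change (P.axes i).mat = (P.axes i).mat *
      Function.update (fun _ : Fin n ⊕ Fin t => (1 : Matrix (Fin 2) (Fin 2) ℂ)) (Sum.inr a)
        Pauli.Z.mat (Sum.inl i)
    rw [Function.update_of_ne (by simp), mul_one]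
  · change (Function.update (fun _ => Pauli.I) a Pauli.Z b).mat = Pauli.I.mat *
      Function.update (fun _ : Fin n ⊕ Fin t => (1 : Matrix (Fin 2) (Fin 2) ℂ)) (Sum.inr a)
        Pauli.Z.mat (Sum.inr b)
    rw [hI, one_mul]
    rcases eq_or_ne b a with rfl | hb
    · rw [Function.update_self, Function.update_self]
    · rw [Function.update_of_ne hb, Function.update_of_ne (by simpa using hb), hI]

theorem SignedPauli.commute_extend {P P' : SignedPauli (Fin n)} (h : Commute P.mat P'.mat) :
    Commute (P.extend fun _ : Fin t => .I).mat (P'.extend fun _ : Fin t => .I).mat := by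
  rw [commute_iff_eq, SignedPauli.extend_mat, SignedPauli.extend_mat, tensorAncilla_mul,
    tensorAncilla_mul, h.eq]

theorem forall₂_imp_of_mem {α β : Type*} {R S : α → β → Prop} {l : List α} {m : List β}
    (h : List.Forall₂ R l m) (hS : ∀ a ∈ l, ∀ b ∈ m, R a b → S a b) : List.Forall₂ S l m := by
  rw [List.forall₂_iff_zip] at h ⊢
  exact ⟨h.1, fun hab => hS _ (List.of_mem_zip hab).1 _ (List.of_mem_zip hab).2 (h.2 hab)⟩

/-- Induction on the rotations, multiplying `A` on the left by the flip `F` of a fresh ancilla `a`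
controlled by `P`. The clause on `b ∉ as` says that the old `A` leaves `Z_a` alone, so `F` takes it
to `P ⊗ Z_a`; the axes already built stay fixed, since `P` commutes with their Paulis and their
ancillas differ from `a`. -/
theorem exists_clifford_conj {Ps : List (SignedPauli (Fin n))} {as : List (Fin t)}
    (hl : Ps.length = as.length) (has : as.Nodup)
    (hPs : Ps.Pairwise fun P Q => Commute P.mat Q.mat) :
    ∃ A A' : Circuit (Fin n ⊕ Fin t), A.IsClifford ∧ A'.IsClifford ∧ A.mat * A'.mat = 1 ∧
      (∀ b ∉ as, Commute A.mat (onQubit Pauli.Z.mat (Sum.inr b))) ∧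
      List.Forall₂ (fun P a => A.mat * onQubit Pauli.Z.mat (Sum.inr a) * A'.mat =
        (P.extend (Function.update (fun _ => .I) a .Z)).mat) Ps as := by
  induction Ps generalizing as with
  | nil =>
    obtain rfl : as = [] := List.length_eq_zero_iff.1 hl.symm
    exact ⟨[], [], by simp [Circuit.IsClifford], by simp [Circuit.IsClifford],
      by simp [Circuit.mat], by simp [Circuit.mat], .nil⟩
  | cons P Ps ih =>
    rcases as with _ | ⟨a, as⟩
    · simp at hl
    rw [List.nodup_cons] at has
    rw [List.pairwise_cons] at hPs
    obtain ⟨A, A', hA, hA', hAA', hcomm, hF⟩ := ih (Nat.succ_injective hl) has.2 hPs.2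
    set E : Op (Fin n ⊕ Fin t) := (P.extend fun _ : Fin t => .I).mat with hE
    have hEq : ∀ (b : Fin t) (u : Matrix (Fin 2) (Fin 2) ℂ), Commute E (onQubit u (Sum.inr b)) :=
      fun b u => SignedPauli.commute_onQubit rfl u
    obtain ⟨F, hFc, hFm⟩ : IsCliffordOp (parityFlip (Sum.inr a) E) :=
      SignedPauli.isCliffordOp_parityFlip rfl
    have hFF : F.mat * F.mat = 1 := by
      rw [hFm, parityFlip_mul_self (hEq a) (SignedPauli.mat_mul_self _)]
    have hFb : ∀ b ≠ a, Commute F.mat (onQubit Pauli.Z.mat (Sum.inr b)) := fun b hb => by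
      have hba : (Sum.inr a : Fin n ⊕ Fin t) ≠ Sum.inr b := by simpa using hb.symm
      rw [hFm]
      exact (onQubit_commute hba _ _).add_left ((hEq b _).mul_left (onQubit_commute hba _ _))
    refine ⟨F ++ A, A' ++ F, hFc.append hA, hA'.append hFc, ?_, ?_, ?_⟩
    · rw [Circuit.mat_append, Circuit.mat_append, mul_assoc, ← mul_assoc A.mat, hAA', one_mul, hFF]
    · intro b hb
      rw [List.mem_cons, not_or] at hb
      rw [Circuit.mat_append]
      exact (hFb b hb.1).mul_left (hcomm b hb.2)
    · have hconj : ∀ M, Circuit.mat (F ++ A) * M * Circuit.mat (A' ++ F) =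
          F.mat * (A.mat * M * A'.mat) * F.mat := fun M => by
        simp only [Circuit.mat_append, mul_assoc]
      refine .cons ?_ ?_
      · rw [hconj, (hcomm a has.1).eq, mul_assoc _ A.mat, hAA', mul_one, hFm,
          parityFlip_conj_Z (hEq a), SignedPauli.extend_update_mat]
      · refine forall₂_imp_of_mem hF fun P' hP' b hb h => ?_
        have hba : b ≠ a := fun h => has.1 (h ▸ hb)
        have hFP : Commute F.mat (P'.extend fun _ : Fin t => .I).mat := by
          have hEP := SignedPauli.commute_extend (t := t) (hPs.1 P' hP')
          have hu : ∀ u, Commute (P'.extend fun _ : Fin t => .I).mat (onQubit u (Sum.inr a)) :=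
            fun u => SignedPauli.commute_onQubit rfl u
          rw [hFm]
          exact (hu _).symm.add_left (hEP.mul_left (hu _).symm)
        rw [hconj, h, SignedPauli.extend_update_mat, (hFP.mul_right (hFb b hba)).eq, mul_assoc, hFF,
          mul_one]

theorem exists_isTLayerOf {Ps : List (SignedPauli (Fin n))} (hl : Ps.length ≤ t)
    (hPs : Ps.Pairwise fun P Q => Commute P.mat Q.mat) :
    ∃ B : Circuit (Fin n ⊕ Fin t), IsTLayerOf Ps B := by
  have hl' : Ps.length = ((List.finRange t).take Ps.length).length := by simp [hl]
  have hnd : ((List.finRange t).take Ps.length).Nodup :=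
    (List.nodup_finRange t).sublist (List.take_sublist _ _)
  obtain ⟨A, A', hA, hA', hAA', -, hF⟩ := exists_clifford_conj hl' hnd hPs
  refine ⟨_, hPs, A, A', _, hA, hA', hAA', hnd.map Sum.inr_injective, ?_, rfl⟩
  rw [List.forall₂_map_right_iff]
  refine hF.imp fun P a h => ⟨_, fun b => ?_, h⟩
  rcases eq_or_ne b a with rfl | hb <;> simp [*]

theorem extendOp_mul (C D : Op (Fin n)) : extendOp t (C * D) = extendOp t C * extendOp t D := by
  rw [extendOp_eq, extendOp_eq, extendOp_eq, tensorAncilla_mul, one_mul]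

theorem extendOp_add (C D : Op (Fin n)) : extendOp t (C + D) = extendOp t C + extendOp t D := by
  ext x y
  simp [extendOp, add_mul]

theorem extendOp_onQubit (u : Matrix (Fin 2) (Fin 2) ℂ) (q : Fin n) :
    extendOp t (onQubit u q) = onQubit u (Sum.inl q) := by
  rw [extendOp_eq, ← tensor_one, onQubit, ← tensor_elim, onQubit]
  congr 1
  funext i
  rcases i with i | b
  · rcases eq_or_ne i q with rfl | hi
    · simp
    · simp [hi]
  · simp

theorem extendOp_one : extendOp t (1 : Op (Fin n)) = 1 := by
  rw [extendOp_eq, ← tensor_one, ← tensor_one, ← tensor_elim, ← tensor_one]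
  congr 1
  funext i
  cases i <;> rfl

theorem isCliffordOp_extendOp {C : Op (Fin n)} (hC : IsCliffordOp C) :
    IsCliffordOp (extendOp t C) := by
  obtain ⟨L, hL, rfl⟩ := hC
  induction L with
  | nil => exact extendOp_one (n := n) (t := t) ▸ isCliffordOp_one
  | cons g L ih =>
    rw [Circuit.mat_cons, extendOp_mul]
    refine IsCliffordOp.mul ?_ (ih fun g hg => hL g (List.mem_cons_of_mem _ hg))
    have hg := hL g List.mem_cons_self
    cases g with
    | H q =>
      rw [Gate.mat, extendOp_onQubit]
      exact isCliffordOp_H _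
    | S q =>
      rw [Gate.mat, extendOp_onQubit]
      exact isCliffordOp_S _
    | T q => exact hg.elim
    | CNOT c d h =>
      rw [Gate.mat, extendOp_add, extendOp_mul, extendOp_onQubit, extendOp_onQubit,
        extendOp_onQubit]
      exact isCliffordOp_gate (g := .CNOT (Sum.inl c) (Sum.inl d) (by simpa using h)) trivial

/-- A partition of the rotations into commuting groups is realised by a circuit whose T-depth is at
most the number of groups. -/
theorem exists_derives {U : RotationForm n} {groups : List (List (SignedPauli (Fin n)))}
    (hs : Relation.ReflTransGen CommSwap U.paulis groups.flatten)
    (hg : ∀ g ∈ groups, g.Pairwise fun P Q => Commute P.mat Q.mat) :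
    ∃ (t : ℕ) (W : Circuit (Fin n ⊕ Fin t)), Derives U t W ∧ W.tDepth ≤ groups.length := by
  -- All groups share one register; as many ancillas as there are rotations suffice for each group
  -- separately.
  obtain ⟨K, hK, hKm⟩ := isCliffordOp_extendOp (t := groups.flatten.length) U.isClifford
  have hblocks : ∀ gs : List (List (SignedPauli (Fin n))), (∀ g ∈ gs, g ∈ groups) →
      ∃ blocks : List (Circuit (Fin n ⊕ Fin groups.flatten.length)),
        List.Forall₂ IsTLayerOf gs blocks := by
    intro gs hgs
    induction gs with
    | nil => exact ⟨[], .nil⟩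
    | cons g gs ih =>
      rw [List.forall_mem_cons] at hgs
      obtain ⟨blocks, hb⟩ := ih hgs.2
      obtain ⟨B, hB⟩ := exists_isTLayerOf
        (List.sublist_flatten_of_mem hgs.1).length_le (hg g hgs.1)
      exact ⟨B :: blocks, .cons hB hb⟩
  obtain ⟨blocks, hb⟩ := hblocks groups fun _ h => h
  exact ⟨_, blocks.flatten ++ K, ⟨groups, blocks, K, hs, hb, hK, hKm, rfl⟩,
    Nat.sInf_le ⟨_, .refl, layered_of_layers hb hK⟩⟩

end Construction

end TDepth

/-! ### Longest path and least T-depth -/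

theorem theorem5 (n : ℕ) (U : TDepth.RotationForm n) :
    (∀ (t : ℕ) (W : TDepth.Circuit (Fin n ⊕ Fin t)),
      TDepth.Derives U t W → TDepth.Implements W U) ∧
    ∃ k : ℕ,
      IsGreatest {l : ℕ | ∃ p : List (Fin U.paulis.length),
        TDepth.IsDiPath U.tGraph p ∧ p.length = l} k ∧
      IsLeast {d : ℕ | ∃ (t : ℕ) (W : TDepth.Circuit (Fin n ⊕ Fin t)),
        TDepth.Derives U t W ∧ W.tDepth = d} k := by
  refine ⟨fun t W h => h.implements, ?_⟩
  obtain ⟨groups, hgr, hs⟩ := TDepth.exists_isGreedy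
    (fun P Q : TDepth.SignedPauli (Fin n) => Commute P.mat Q.mat) U.paulis
  have hchain := hgr.hasChain_length (fun _ _ h => h.symm) hs
  have hpw := fun g hg => (hgr.1 g hg).1
  obtain ⟨t, W, hW, hle⟩ := TDepth.exists_derives
    (Relation.ReflTransGen.mono (fun _ _ h => TDepth.commSwap_iff.2 h) _ _ hs) hpw
  -- The number of greedy blocks is the common value: the blocks bound every chain from above, and
  -- the chain through them bounds every T-depth from below.
  refine ⟨groups.length, ⟨(TDepth.exists_isDiPath_iff U _).2 hchain, fun l hl => ?_⟩,
    ⟨t, W, hW, hle.antisymm (hW.le_tDepth hchain)⟩, ?_⟩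
  · exact (TDepth.hasChain_of_reflTransGen hs ((TDepth.exists_isDiPath_iff U l).1 hl)).le_length hpw
  · rintro d ⟨t, W, hW, rfl⟩
    exact hW.le_tDepth hchain
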